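/- Let $N\ge 1$, let $\lambda_1,\dots,\lambda_N$ be distinct real numbers and $\mu_1,\dots,\mu_N$ nonzero real numbers, and put $B=\mathrm{diag}(\mu_1,\dots,\mu_N)$. For $P_i=(\phi_{i1},\dots,\phi_{iN})^T$ and $Q_i=(\psi_{i1},\dots,\psi_{iN})^T$ in $\mathbb R^N$, $1\le i\le 3$, put $$q=\sqrt2\,(\langle P_1,BQ_2\rangle+\langle P_2,BQ_3\rangle),\qquad r=\sqrt2\,(\langle P_2,BQ_1\rangle+\langle P_3,BQ_2\rangle)$$ (the Bargmann constraint), and let $$U(q,r,\lambda)=\begin{pmatrix}-2\lambda&\sqrt2 q&0\\ \sqrt2 r&0&\sqrt2 q\\ 0&\sqrt2 r&2\lambda\end{pmatrix},\qquad V(a,b,c)=\begin{pmatrix}2a&\sqrt2 b&0\\ \sqrt2 c&0&\sqrt2 b\\ 0&\sqrt2 c&-2a\end{pmatrix}.$$ The nonlinearized spatial system is the system of ordinary differential equations on $\mathbb R^{6N}$ $$\phi^{(j)}_x=U(q,r,\lambda_j)\phi^{(j)},\qquad \psi^{(j)}_x=-U(q,r,\lambda_j)^T\psi^{(j)},\qquad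 1\le j\le N,$$ where $\phi^{(j)}=(\phi_{1j},\phi_{2j},\phi_{3j})^T$, $\psi^{(j)}=(\psi_{1j},\psi_{2j},\psi_{3j})^T$. An integral of motion of it is a smooth function on $\mathbb R^{6N}$ that is constant along each of its solutions on each open interval. The AKNS vector fields are $K_n=(-2b_{n+1},\,2c_{n+1})^T$, $n\ge0$, where $a_i,b_i,c_i$ are the polynomials in $q,r$ and their $x$-derivatives given by $a_0=-1$, $b_0=c_0=0$ and $$a_{i+1}=\tfrac12\partial^{-1}(q\,c_{i,x}+r\,b_{i,x}),\quad b_{i+1}=-\tfrac12 b_{i,x}-q a_i,\quad c_{i+1}=\tfrac12 c_{i,x}-r a_i,\qquad i\ge0,$$ the constant of integration in $\partial^{-1}$ being chosen so that $a_{i+1}=0$ at $q=r=0$. Then there are $N$ integrals of motion $\alpha_0,\dots,\alpha_{N-1}$ of the nonlinearized spatial system such that for every solution $(P_1,P_2,P_3,Q_1,Q_2,Q_3)$ of it on an open interval $I$, the functions $q$ and $r$ are smooth on $I$ and solve there the $N$-th order stationary AKNS equation $$K_N+\sum_{i=0}^{N-1}\alpha_iK_i=0,$$ where $\alpha_i$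 is evaluated at the solution. In particular, $(q,r)$ is a finite-gap potential on $I$ of the spectral problem $\phi_x=U(q,r,\lambda)\phi$, i.e. for some $n\ge0$ there is a matrix $W(x,\lambda)=V(a,b,c)$, with $a,b,c$ polynomials of degree at most $n$ in $\lambda$ whose coefficients are functions of $x$, the coefficient of $\lambda^n$ in $a$ being $-1$, that satisfies $W_x=[U(q,r,\lambda),W]$ for all $x\in I$ and all $\lambda\in\mathbb R$. -/

import Mathlib

open scoped ContDiff

noncomputable section

namespace AKNS

/-! ### Differential polynomials in two functions -/

/-- Real differential polynomials in `q`, `r`: the variable `(0, k)` is the `k`-th `x`-derivative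
of `q`, the variable `(1, k)` is the `k`-th `x`-derivative of `r`. -/
abbrev DiffPoly : Type := MvPolynomial (Fin 2 × ℕ) ℝ

/-- The differential polynomial `q`. -/
def dq : DiffPoly := MvPolynomial.X (0, 0)

/-- The differential polynomial `r`. -/
def dr : DiffPoly := MvPolynomial.X (1, 0)

/-- The total derivative `∂ = d/dx` on differential polynomials. -/
def D : Derivation ℝ DiffPoly DiffPoly :=
  MvPolynomial.mkDerivation ℝ (fun s => MvPolynomial.X (s.1, s.2 + 1))

open Classical in
/-- The inverse `∂⁻¹` of the total derivative, with zero constant of integration: `∂⁻¹ p` is the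
differential polynomial `g` with `∂ g = p` and `g = 0` at `q = r = 0` (unique by `eq_of_D_eq`;
the value is `0` if `p` is not a total derivative). -/
def Dinv (p : DiffPoly) : DiffPoly :=
  if h : ∃ g : DiffPoly, D g = p ∧ MvPolynomial.constantCoeff g = 0 then h.choose else 0

/-- The coefficients `(aᵢ, bᵢ, cᵢ)` of the solution `V` of `V_x = [U, V]`:
`a₀ = -1`, `b₀ = c₀ = 0`, `aᵢ₊₁ = ½ ∂⁻¹ (q ∂cᵢ + r ∂bᵢ)`, `bᵢ₊₁ = -½ ∂bᵢ - q aᵢ`,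
`cᵢ₊₁ = ½ ∂cᵢ - r aᵢ`. -/
def coeffs : ℕ → DiffPoly × DiffPoly × DiffPoly
  | 0 => (-1, 0, 0)
  | i + 1 =>
    ((1 / 2 : ℝ) • Dinv (dq * D (coeffs i).2.2 + dr * D (coeffs i).2.1),
      -((1 / 2 : ℝ) • D (coeffs i).2.1) - dq * (coeffs i).1,
      (1 / 2 : ℝ) • D (coeffs i).2.2 - dr * (coeffs i).1)

/-- `aᵢ` -/
def ca (i : ℕ) : DiffPoly := (coeffs i).1

/-- `bᵢ` -/
def cb (i : ℕ) : DiffPoly := (coeffs i).2.1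

/-- `cᵢ` -/
def cc (i : ℕ) : DiffPoly := (coeffs i).2.2

/-- The AKNS vector fields `Kₙ = (-2 bₙ₊₁, 2 cₙ₊₁)ᵀ`; component `0` is the right-hand side of the
equation for `q`, component `1` that of the equation for `r`. -/
def K (n : ℕ) : Fin 2 → DiffPoly := ![(-2 : ℝ) • cb (n + 1), (2 : ℝ) • cc (n + 1)]

/-- The value of a differential polynomial at `x` along the functions `q`, `r`. -/
def evalAt (q r : ℝ → ℝ) (x : ℝ) (p : DiffPoly) : ℝ :=
  MvPolynomial.eval (fun s => iteratedDeriv s.2 (![q, r] s.1) x) p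

/-! ### The recursion is well defined -/

theorem D_X (s : Fin 2 × ℕ) : D (MvPolynomial.X s) = MvPolynomial.X (s.1, s.2 + 1) :=
  MvPolynomial.mkDerivation_X _ _ _

theorem constantCoeff_D (p : DiffPoly) : MvPolynomial.constantCoeff (D p) = 0 := by
  induction p using MvPolynomial.induction_on with
  | C a => simp [D]
  | add p q hp hq => simp [hp, hq]
  | mul_X p s hp => simp [D_X, hp]

theorem pderiv_D (i : Fin 2) (n : ℕ) (p : DiffPoly) :
    MvPolynomial.pderiv (i, n + 1) (D p)
      = MvPolynomial.pderiv (i, n) p + D (MvPolynomial.pderiv (i, n + 1) p) := by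
  induction p using MvPolynomial.induction_on with
  | C a => simp [D]
  | add p q hp hq => simp only [map_add, hp, hq]; ring
  | mul_X p s hp =>
    have h1 : MvPolynomial.pderiv (i, n + 1) (MvPolynomial.X (R := ℝ) (s.1, s.2 + 1))
        = MvPolynomial.pderiv (i, n) (MvPolynomial.X s) := by
      obtain ⟨j, m⟩ := s
      simp [MvPolynomial.pderiv_X, Pi.single_apply, Prod.ext_iff]
    have h2 : D (MvPolynomial.pderiv (i, n + 1) (MvPolynomial.X (R := ℝ) s)) = 0 := by
      by_cases h : s = (i, n + 1) <;> simp [MvPolynomial.pderiv_X, h]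
    simp only [Derivation.leibniz, D_X, map_add, smul_eq_mul, hp, h1, h2]
    ring

/-- A differential polynomial whose total derivative vanishes is a constant. -/
theorem eq_C_of_D_eq_zero (p : DiffPoly) (hp : D p = 0) :
    p = MvPolynomial.C (MvPolynomial.constantCoeff p) := by
  have hbig : ∃ M : ℕ, ∀ i : Fin 2, ∀ n, M ≤ n → MvPolynomial.pderiv (i, n) p = 0 := by
    refine ⟨p.vars.sup (fun s => s.2) + 1, fun i n hn => ?_⟩
    apply MvPolynomial.pderiv_eq_zero_of_notMem_vars
    intro h
    have : n ≤ p.vars.sup (fun s => s.2) :=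
      Finset.le_sup (f := fun s : Fin 2 × ℕ => s.2) h
    omega
  obtain ⟨M, hM⟩ := hbig
  have hall : ∀ k, k ≤ M → ∀ i : Fin 2, MvPolynomial.pderiv (i, M - k) p = 0 := by
    intro k
    induction k with
    | zero => intro _ i; exact hM i M le_rfl
    | succ k ih =>
      intro hk i
      have h := pderiv_D i (M - (k + 1)) p
      rw [show M - (k + 1) + 1 = M - k by omega, ih (by omega) i, hp] at h
      simpa using h.symm
  have hz : ∀ s : Fin 2 × ℕ, MvPolynomial.pderiv s p = 0 := by
    rintro ⟨i, n⟩
    rcases le_total M n with h | h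
    · exact hM i n h
    · have := hall (M - n) (by omega) i
      rwa [show M - (M - n) = n by omega] at this
  ext m
  rw [MvPolynomial.coeff_C]
  split_ifs with h
  · rw [← h]; rfl
  · obtain ⟨s, hs⟩ : ∃ s, m s ≠ 0 := by
      by_contra! hcon
      exact h (Finsupp.ext fun s => (hcon s).symm)
    have h0 := congrArg (MvPolynomial.coeff (m - Finsupp.single s 1)) (hz s)
    rw [MvPolynomial.coeff_pderiv] at h0
    have hle : Finsupp.single s 1 ≤ m := by
      rw [Finsupp.single_le_iff]; omega
    rw [tsub_add_cancel_of_le hle] at h0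
    simp only [MvPolynomial.coeff_zero, mul_eq_zero] at h0
    rcases h0 with h0 | h0
    · exact h0
    · exfalso
      norm_cast at h0

theorem eq_of_D_eq (p g h : DiffPoly) (hg : D g = p) (hg0 : MvPolynomial.constantCoeff g = 0)
    (hh : D h = p) (hh0 : MvPolynomial.constantCoeff h = 0) : g = h := by
  have := eq_C_of_D_eq_zero (g - h) (by simp [hg, hh])
  rw [map_sub, hg0, hh0, sub_zero, map_zero] at this
  exact sub_eq_zero.mp this

theorem Dinv_spec (p g : DiffPoly) (hg : D g = p) (hg0 : MvPolynomial.constantCoeff g = 0) :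
    Dinv p = g := by
  have h : ∃ g : DiffPoly, D g = p ∧ MvPolynomial.constantCoeff g = 0 := ⟨g, hg, hg0⟩
  rw [Dinv, dif_pos h]
  exact eq_of_D_eq p _ _ h.choose_spec.1 h.choose_spec.2 hg hg0

theorem D_cb (i : ℕ) : D (cb i) = (-2 : ℝ) • cb (i + 1) - (2 : ℝ) • (dq * ca i) := by
  simp only [cb, ca, coeffs]; module

theorem D_cc (i : ℕ) : D (cc i) = (2 : ℝ) • cc (i + 1) + (2 : ℝ) • (dr * ca i) := by
  simp only [cc, ca, coeffs]; module

theorem constantCoeff_cb (i : ℕ) : MvPolynomial.constantCoeff (cb i) = 0 := by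
  cases i with
  | zero => simp [cb, coeffs]
  | succ i => simp [cb, coeffs, constantCoeff_D, dq, MvPolynomial.smul_eq_C_mul]

/-- The recursion is solvable in differential polynomials: `∂aᵢ = q cᵢ - r bᵢ`, and
`aᵢ` vanishes at `q = r = 0` for `i ≥ 1`. -/
theorem D_ca (n : ℕ) : D (ca n) = dq * cc n - dr * cb n ∧
    (1 ≤ n → MvPolynomial.constantCoeff (ca n) = 0) := by
  induction n using Nat.strong_induction_on with
  | _ n ih =>
  cases n with
  | zero => simp [ca, cb, cc, coeffs]
  | succ n =>
    set g : DiffPoly := ∑ i ∈ Finset.range n,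
      (ca (i + 1) * ca (n - i) + cb (i + 1) * cc (n - i)) with hgdef
    have hP : dq * D (cc n) + dr * D (cb n) = (2 : ℝ) • (dq * cc (n + 1) - dr * cb (n + 1)) := by
      rw [D_cb, D_cc]; simp only [MvPolynomial.smul_eq_C_mul, map_neg]; ring
    have hg0 : MvPolynomial.constantCoeff g = 0 := by
      rw [hgdef, map_sum]
      refine Finset.sum_eq_zero fun i hi => ?_
      have hi' := Finset.mem_range.mp hi
      simp [(ih (i + 1) (by omega)).2 (by omega), constantCoeff_cb]
    have hgD : D g = dq * D (cc n) + dr * D (cb n) := by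
      rw [hP]
      have htel := Finset.sum_range_sub' (fun i => cb (i + 1) * cc (n + 1 - i)) n
      have hr1 : ∑ i ∈ Finset.range n, (dq * cc (i + 1) - dr * cb (i + 1)) * ca (n - i)
          = ∑ i ∈ Finset.range n, (dq * cc (n - i) - dr * cb (n - i)) * ca (i + 1) := by
        rw [← Finset.sum_range_reflect]
        refine Finset.sum_congr rfl fun i hi => ?_
        have hi' := Finset.mem_range.mp hi
        rw [show n - 1 - i + 1 = n - i by omega, show n - (n - 1 - i) = i + 1 by omega]
      have hr2 : ∑ i ∈ Finset.range n, cb (i + 1) * ca (n - i)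
          = ∑ i ∈ Finset.range n, cb (n - i) * ca (i + 1) := by
        rw [← Finset.sum_range_reflect]
        refine Finset.sum_congr rfl fun i hi => ?_
        have hi' := Finset.mem_range.mp hi
        rw [show n - 1 - i + 1 = n - i by omega, show n - (n - 1 - i) = i + 1 by omega]
      have hterm : ∀ i ∈ Finset.range n,
          D (ca (i + 1) * ca (n - i) + cb (i + 1) * cc (n - i))
            = (dq * cc (i + 1) - dr * cb (i + 1)) * ca (n - i)
              + (dq * cc (n - i) - dr * cb (n - i)) * ca (i + 1)
              - 2 * dq * (cc (n - i) * ca (i + 1)) + 2 * dr * (cb (i + 1) * ca (n - i))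
              + 2 * (cb (i + 1) * cc (n + 1 - i) - cb (i + 1 + 1) * cc (n + 1 - (i + 1))) := by
        intro i hi
        have hi' := Finset.mem_range.mp hi
        rw [map_add, Derivation.leibniz, Derivation.leibniz, (ih (i + 1) (by omega)).1,
          (ih (n - i) (by omega)).1, D_cb, D_cc, show n - i + 1 = n + 1 - i by omega,
          show n + 1 - (i + 1) = n - i by omega]
        have h2 : (MvPolynomial.C (2 : ℝ) : DiffPoly) = 2 := map_ofNat _ 2
        simp only [smul_eq_mul, MvPolynomial.smul_eq_C_mul, map_neg, h2]
        ring
      have hsplit : ∑ i ∈ Finset.range n, (dq * cc (n - i) - dr * cb (n - i)) * ca (i + 1)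
          = dq * ∑ i ∈ Finset.range n, cc (n - i) * ca (i + 1)
            - dr * ∑ i ∈ Finset.range n, cb (n - i) * ca (i + 1) := by
        rw [Finset.mul_sum, Finset.mul_sum, ← Finset.sum_sub_distrib]
        exact Finset.sum_congr rfl fun i _ => by ring
      have hb1 : cb 1 = dq := by simp [cb, coeffs]
      have hc1 : cc 1 = dr := by simp [cc, coeffs]
      have h2 : (MvPolynomial.C (2 : ℝ) : DiffPoly) = 2 := map_ofNat _ 2
      simp only [zero_add, Nat.sub_zero, hb1, show n + 1 - n = 1 by omega, hc1] at htel
      rw [hgdef, map_sum, Finset.sum_congr rfl hterm, Finset.sum_add_distrib,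
        Finset.sum_add_distrib, Finset.sum_sub_distrib, Finset.sum_add_distrib,
        ← Finset.mul_sum, ← Finset.mul_sum, ← Finset.mul_sum, htel, hr1, hr2, hsplit,
        MvPolynomial.smul_eq_C_mul, h2]
      ring
    have hinv : Dinv (dq * D (cc n) + dr * D (cb n)) = g := Dinv_spec _ _ hgD hg0
    have hca : ca (n + 1) = (1 / 2 : ℝ) • g := by
      rw [← hinv]; rfl
    refine ⟨?_, fun _ => ?_⟩
    · rw [hca, Derivation.map_smul, hgD, hP, smul_smul]; norm_num
    · rw [hca, MvPolynomial.smul_eq_C_mul, map_mul, hg0, mul_zero]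

/-! ### The spectral problem and the Bargmann-constrained system -/

/-- The spectral matrix `U(u, l)`, `u = (q, r)`. -/
def U (q r l : ℝ) : Matrix (Fin 3) (Fin 3) ℝ :=
  !![-2 * l, √2 * q, 0;
     √2 * r, 0, √2 * q;
     0, √2 * r, 2 * l]

/-- The matrix `V` built from `a`, `b`, `c`. -/
def V (a b c : ℝ) : Matrix (Fin 3) (Fin 3) ℝ :=
  !![2 * a, √2 * b, 0;
     √2 * c, 0, √2 * b;
     0, √2 * c, -2 * a]

/-- The phase space `ℝ^{6N}`: a point is `(P, Q)`, where `P i j` is the `j`-th component of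
`P_{i+1}` (the entry `φ_{i+1,j}`) and `Q i j` is the `j`-th component of `Q_{i+1}`
(the entry `ψ_{i+1,j}`). -/
abbrev Phase (N : ℕ) : Type := (Fin 3 → Fin N → ℝ) × (Fin 3 → Fin N → ℝ)

variable {N : ℕ}

/-- `⟨x, B y⟩` with `B = diag(mu)`. -/
def pairB (mu x y : Fin N → ℝ) : ℝ := x ⬝ᵥ (Matrix.diagonal mu).mulVec y

/-- The potential `q = √2 (⟨P₁, B Q₂⟩ + ⟨P₂, B Q₃⟩)`. -/
def potQ (mu : Fin N → ℝ) (z : Phase N) : ℝ :=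
  √2 * (pairB mu (z.1 0) (z.2 1) + pairB mu (z.1 1) (z.2 2))

/-- The potential `r = √2 (⟨P₂, B Q₁⟩ + ⟨P₃, B Q₂⟩)`. -/
def potR (mu : Fin N → ℝ) (z : Phase N) : ℝ :=
  √2 * (pairB mu (z.1 1) (z.2 0) + pairB mu (z.1 2) (z.2 1))

/-- `z = (P, Q)` solves the nonlinearized spatial system on `I`:
`φ⁽ʲ⁾_x = U(f, λ_j) φ⁽ʲ⁾` and `ψ⁽ʲ⁾_x = -U(f, λ_j)ᵀ ψ⁽ʲ⁾` for all `j`, where `f = (q, r)` is the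
Bargmann-constrained potential. -/
def IsSolution (lam mu : Fin N → ℝ) (I : Set ℝ) (z : ℝ → Phase N) : Prop :=
  ∀ x ∈ I, ∀ (j : Fin N) (i : Fin 3),
    HasDerivAt (fun y => (z y).1 i j)
      ((U (potQ mu (z x)) (potR mu (z x)) (lam j)).mulVec (fun k => (z x).1 k j) i) x ∧
    HasDerivAt (fun y => (z y).2 i j)
      ((-(U (potQ mu (z x)) (potR mu (z x)) (lam j)).transpose).mulVec
        (fun k => (z x).2 k j) i) x

/-- A smooth function on phase space is an integral of motion of the nonlinearized spatial system
if it is constant along every solution on every open interval. -/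
def IsIntegralOfMotion (lam mu : Fin N → ℝ) (α : Phase N → ℝ) : Prop :=
  ContDiff ℝ ∞ α ∧
    ∀ I : Set ℝ, IsOpen I → I.OrdConnected → ∀ z : ℝ → Phase N, IsSolution lam mu I z →
      ∀ x ∈ I, ∀ y ∈ I, α (z x) = α (z y)

/-- The matrix polynomial `W(x, l) = V(a, b, c)` of degree `n` in `l`, where
`a = ∑ aₖ(x) lᵏ`, `b = ∑ bₖ(x) lᵏ`, `c = ∑ cₖ(x) lᵏ`, `0 ≤ k ≤ n`. -/
def polyV (n : ℕ) (a b c : ℕ → ℝ → ℝ) (x l : ℝ) : Matrix (Fin 3) (Fin 3) ℝ :=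
  V (∑ k ∈ Finset.range (n + 1), a k x * l ^ k) (∑ k ∈ Finset.range (n + 1), b k x * l ^ k)
    (∑ k ∈ Finset.range (n + 1), c k x * l ^ k)

/-- `(q, r)` is a finite-gap (algebro-geometric) potential on `I` of the spectral problem
`φ_x = U(q, r, l) φ`: the equation `W_x = [U, W]` has a solution `W = V(a, b, c)` that is a
polynomial in the spectral parameter `l`, of some degree `n`, normalized so that the coefficient
of `l ^ n` in `a` is `-1`. -/
def IsFiniteGap (I : Set ℝ) (q r : ℝ → ℝ) : Prop :=
  ∃ (n : ℕ) (a b c : ℕ → ℝ → ℝ), (∀ x ∈ I, a n x = -1) ∧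
    ∀ x ∈ I, ∀ l : ℝ, ∀ i j : Fin 3,
      HasDerivAt (fun y => polyV n a b c y l i j)
        ((U (q x) (r x) l * polyV n a b c x l - polyV n a b c x l * U (q x) (r x) l) i j) x

end AKNS

end

/-! The spectral matrix `U(q, r, l)` is the image of the `sl₂` matrix with rows `(-l, q)`, `(r, l)`
in the three-dimensional representation, and `V(a, b, c)` is the image of the one with rows
`(a, b)`, `(c, -a)`. Along a solution each rank-one matrix `M = φ⁽ʲ⁾ ψ⁽ʲ⁾ᵀ` satisfies
`M_x = [U(q, r, λⱼ), M]`, and so does `4` times its projection to the matrices `V(a, b, c)`, called `Vⱼ` here (its components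
are `eigA`, `eigB`, `eigC`).
Put `L = V(-1, 0, 0) + ∑ⱼ μⱼ Vⱼ / (l - λⱼ)`. Because the Bargmann constraint identifies `q`, `r`
with the leading coefficients of `b`, `c`, the matrix `L` satisfies `L_x = [U, L]`
(`bargmann_isLaxSeries`). Multiplied by `∏ⱼ (l - λⱼ)` it becomes a polynomial of degree `N` in `l`,
which is the finite-gap property (`IsSolution.isFiniteGap`).

For the stationary equation, expand in powers of `t = l⁻¹`. A solution of the Lax equation with
`a₀ = -1` is determined by the invariant `a² + bc` (`IsLaxSeries.eq`), which does not depend on `x`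
(`IsLaxSeries.det_eq`). The standard solution `(∑ aᵢ tⁱ, ∑ bᵢ tⁱ, ∑ cᵢ tⁱ)` has `a² + bc = 1`
(`standard_det`), so `L` is the standard solution multiplied by the scalar series
`γ = √(a² + bc)` formed from `L` (`momentSeries_eq`); its coefficients are polynomial integrals of
motion. Since `∏ⱼ (l - λⱼ) L` has no term in `l⁻¹`, comparing coefficients gives the stationary
equation, `αᵢ` being the coefficient of `lⁱ` in `∏ⱼ (l - λⱼ) γ` (`sum_motionIntegral_mul_coeff`). -/

open scoped PowerSeries

noncomputable section

namespace AKNS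

open PowerSeries (coeff)

/-! ### Square roots of power series -/

/-- The coefficients of the square root, with constant term `1`, of a power series whose constant
term is `1`; the constant term of `f` itself is not used. -/
def sqrtCoeff (f : ℝ⟦X⟧) : ℕ → ℝ
  | 0 => 1
  | n + 1 => (coeff (n + 1) f - ∑ k : Fin n, sqrtCoeff f (k + 1) * sqrtCoeff f (n - k)) / 2
  termination_by n => n
  decreasing_by all_goals omega

/-- The square root with constant term `1` of a power series with constant term `1`. -/
def sqrtSeries (f : ℝ⟦X⟧) : ℝ⟦X⟧ := PowerSeries.mk (sqrtCoeff f)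

theorem coeff_zero_sqrtSeries (f : ℝ⟦X⟧) : coeff 0 (sqrtSeries f) = 1 := by
  rw [sqrtSeries, PowerSeries.coeff_mk, sqrtCoeff]

theorem sqrtSeries_mul_self {f : ℝ⟦X⟧} (hf : coeff 0 f = 1) :
    sqrtSeries f * sqrtSeries f = f := by
  ext n
  cases n with
  | zero => rw [PowerSeries.coeff_mul, Finset.Nat.antidiagonal_zero,
      Finset.sum_singleton, coeff_zero_sqrtSeries, hf, one_mul]
  | succ n =>
    have h0 : sqrtCoeff f 0 = 1 := by rw [sqrtCoeff]
    have h1 : 2 * sqrtCoeff f (n + 1) + ∑ k ∈ Finset.range n,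
        sqrtCoeff f (k + 1) * sqrtCoeff f (n - k) = coeff (n + 1) f := by
      rw [sqrtCoeff, Fin.sum_univ_eq_sum_range
        (fun k => sqrtCoeff f (k + 1) * sqrtCoeff f (n - k)) n]
      ring
    rw [PowerSeries.coeff_mul, Finset.Nat.sum_antidiagonal_eq_sum_range_succ_mk,
      Finset.sum_range_succ, Finset.sum_range_succ', ← h1]
    simp only [sqrtSeries, PowerSeries.coeff_mk, Nat.add_sub_add_right, Nat.sub_self,
      Nat.sub_zero, h0]
    ring

theorem contDiff_coeff_mul {E : Type*} [NormedAddCommGroup E] [NormedSpace ℝ E]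
    {F G : E → ℝ⟦X⟧} (hF : ∀ n, ContDiff ℝ ∞ fun z => coeff n (F z))
    (hG : ∀ n, ContDiff ℝ ∞ fun z => coeff n (G z)) (n : ℕ) :
    ContDiff ℝ ∞ fun z => coeff n (F z * G z) := by
  simp only [PowerSeries.coeff_mul]
  exact ContDiff.sum fun p _ => (hF p.1).mul (hG p.2)

theorem contDiff_coeff_sqrtSeries {E : Type*} [NormedAddCommGroup E] [NormedSpace ℝ E]
    {F : E → ℝ⟦X⟧} (hF : ∀ n, ContDiff ℝ ∞ fun z => coeff n (F z)) (n : ℕ) :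
    ContDiff ℝ ∞ fun z => coeff n (sqrtSeries (F z)) := by
  simp only [sqrtSeries, PowerSeries.coeff_mk]
  induction n using Nat.strong_induction_on with
  | _ n ih =>
  cases n with
  | zero =>
    have h : ∀ f, sqrtCoeff f 0 = 1 := fun f => by rw [sqrtCoeff]
    simpa only [h] using contDiff_const
  | succ n =>
    have h : ∀ f, sqrtCoeff f (n + 1) = (coeff (n + 1) f
        - ∑ k : Fin n, sqrtCoeff f (k + 1) * sqrtCoeff f (n - k)) / 2 :=
      fun f => by rw [sqrtCoeff]
    simp only [h]
    exact ((hF _).sub (ContDiff.sum fun k _ =>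
      (ih _ (by omega)).mul (ih _ (by omega)))).div_const 2

/-! ### Series solutions of the Lax equation -/

/-- A family `(a, b, c)` of power series in `t = l⁻¹`, depending on `x`, such that the matrix
`V(a, b, c)` solves the Lax equation `V_x = [U(q, r, l), V]` on `I`. The equation is written
coefficient by coefficient; the constant terms of `b` and `c` vanish. -/
structure IsLaxSeries (q r : ℝ → ℝ) (I : Set ℝ) (a b c : ℝ → ℝ⟦X⟧) : Prop where
  hasDerivAt_a : ∀ x ∈ I, ∀ n, HasDerivAt (fun y => coeff n (a y))
    (q x * coeff n (c x) - r x * coeff n (b x)) x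
  hasDerivAt_b : ∀ x ∈ I, ∀ n, HasDerivAt (fun y => coeff n (b y))
    (-2 * coeff (n + 1) (b x) - 2 * (q x * coeff n (a x))) x
  hasDerivAt_c : ∀ x ∈ I, ∀ n, HasDerivAt (fun y => coeff n (c y))
    (2 * coeff (n + 1) (c x) + 2 * (r x * coeff n (a x))) x
  coeff_zero_b : ∀ x, coeff 0 (b x) = 0
  coeff_zero_c : ∀ x, coeff 0 (c x) = 0

theorem hasDerivAt_coeff_mul {f g : ℝ → ℝ⟦X⟧} {f' g' : ℝ⟦X⟧} {x : ℝ}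
    (hf : ∀ n, HasDerivAt (fun y => coeff n (f y)) (coeff n f') x)
    (hg : ∀ n, HasDerivAt (fun y => coeff n (g y)) (coeff n g') x) (n : ℕ) :
    HasDerivAt (fun y => coeff n (f y * g y)) (coeff n (f' * g x + f x * g')) x := by
  simp only [map_add, PowerSeries.coeff_mul, ← Finset.sum_add_distrib]
  exact HasDerivAt.fun_sum fun p _ => (hf p.1).mul (hg p.2)

theorem eq_X_mul_shift {R : Type*} [CommSemiring R] {f : R⟦X⟧} (hf : coeff 0 f = 0) :
    f = PowerSeries.X * PowerSeries.mk fun n => coeff (n + 1) f := by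
  ext n
  cases n with
  | zero => simpa using hf
  | succ n => rw [PowerSeries.coeff_succ_X_mul, PowerSeries.coeff_mk]

/-- The derivative of `a² + bc` along the Lax equation vanishes; `X * B` and `X * C` are the
series `b` and `c`, whose constant terms are zero. -/
theorem lax_derivative_det {R : Type*} [CommRing R] (q r a B C : R) (X : R) :
    (q * (X * C) - r * (X * B)) * a + a * (q * (X * C) - r * (X * B))
      + ((-2 * B - 2 * (q * a)) * (X * C) + X * B * (2 * C + 2 * (r * a))) = 0 := by
  ring

variable {q r : ℝ → ℝ} {I : Set ℝ} {a b c : ℝ → ℝ⟦X⟧}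

theorem two_eq_C : (2 : ℝ⟦X⟧) = PowerSeries.C 2 := (map_ofNat _ 2).symm

theorem IsLaxSeries.coeff_deriv_a (h : IsLaxSeries q r I a b c) {x : ℝ} (hx : x ∈ I) (n : ℕ) :
    HasDerivAt (fun y => coeff n (a y))
      (coeff n (PowerSeries.C (q x) * c x - PowerSeries.C (r x) * b x)) x := by
  simpa only [map_sub, PowerSeries.coeff_C_mul] using h.hasDerivAt_a x hx n

theorem IsLaxSeries.coeff_deriv_b (h : IsLaxSeries q r I a b c) {x : ℝ} (hx : x ∈ I) (n : ℕ) :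
    HasDerivAt (fun y => coeff n (b y)) (coeff n (-2 * (PowerSeries.mk fun n => coeff (n + 1) (b x))
      - 2 * (PowerSeries.C (q x) * a x))) x := by
  simpa only [map_sub, map_neg, neg_mul, two_eq_C, PowerSeries.coeff_C_mul, PowerSeries.coeff_mk]
    using h.hasDerivAt_b x hx n

theorem IsLaxSeries.coeff_deriv_c (h : IsLaxSeries q r I a b c) {x : ℝ} (hx : x ∈ I) (n : ℕ) :
    HasDerivAt (fun y => coeff n (c y)) (coeff n (2 * (PowerSeries.mk fun n => coeff (n + 1) (c x))
      + 2 * (PowerSeries.C (r x) * a x))) x := by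
  simpa only [map_add, two_eq_C, PowerSeries.coeff_C_mul, PowerSeries.coeff_mk]
    using h.hasDerivAt_c x hx n

/-- `a² + bc`, which is `-det` of the traceless matrix with rows `(a, b)`, `(c, -a)`, is
independent of `x`. -/
theorem IsLaxSeries.det_eq (h : IsLaxSeries q r I a b c) (hI : IsOpen I) (hc : I.OrdConnected)
    {x y : ℝ} (hx : x ∈ I) (hy : y ∈ I) :
    a x * a x + b x * c x = a y * a y + b y * c y := by
  ext n
  have hd : ∀ x ∈ I, HasDerivAt (fun x => coeff n (a x * a x + b x * c x)) 0 x := by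
    intro x hx
    have h1 := (hasDerivAt_coeff_mul (h.coeff_deriv_a hx) (h.coeff_deriv_a hx) n).fun_add
      (hasDerivAt_coeff_mul (h.coeff_deriv_b hx) (h.coeff_deriv_c hx) n)
    have h2 := lax_derivative_det (PowerSeries.C (q x)) (PowerSeries.C (r x)) (a x)
      (PowerSeries.mk fun n => coeff (n + 1) (b x)) (PowerSeries.mk fun n => coeff (n + 1) (c x))
      PowerSeries.X
    rw [← eq_X_mul_shift (h.coeff_zero_b x), ← eq_X_mul_shift (h.coeff_zero_c x)] at h2
    rw [← map_add, h2, map_zero] at h1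
    simpa only [map_add] using h1
  exact hI.is_const_of_deriv_eq_zero hc.isPreconnected
    (fun x hx => (hd x hx).differentiableAt.differentiableWithinAt)
    (fun x hx => (hd x hx).deriv) hx hy

theorem IsLaxSeries.const_mul (h : IsLaxSeries q r I a b c) (g : ℝ⟦X⟧) :
    IsLaxSeries q r I (fun x => g * a x) (fun x => g * b x) (fun x => g * c x) := by
  have hg : ∀ x n, HasDerivAt (fun _ : ℝ => coeff n g) (coeff n (0 : ℝ⟦X⟧)) x := fun x n => by
    simpa only [map_zero] using hasDerivAt_const x (coeff n g)
  have hs : ∀ (f : ℝ⟦X⟧) (n : ℕ), coeff 0 f = 0 →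
      coeff (n + 1) (g * f) = coeff n (g * PowerSeries.mk fun n => coeff (n + 1) f) := by
    intro f n hf
    conv_lhs => rw [eq_X_mul_shift hf]
    rw [mul_left_comm, PowerSeries.coeff_succ_X_mul]
  refine ⟨fun x hx n => ?_, fun x hx n => ?_, fun x hx n => ?_, fun x => ?_, fun x => ?_⟩
  · convert hasDerivAt_coeff_mul (hg x) (h.coeff_deriv_a hx) n using 1
    rw [zero_mul, zero_add, mul_sub, mul_left_comm, mul_left_comm g, map_sub,
      PowerSeries.coeff_C_mul, PowerSeries.coeff_C_mul]
  · convert hasDerivAt_coeff_mul (hg x) (h.coeff_deriv_b hx) n using 1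
    rw [hs _ n (h.coeff_zero_b x), ← PowerSeries.coeff_C_mul (φ := g * a x), two_eq_C, neg_mul,
      neg_mul, ← PowerSeries.coeff_C_mul, ← PowerSeries.coeff_C_mul, ← map_neg, ← map_sub]
    congr 1
    ring
  · convert hasDerivAt_coeff_mul (hg x) (h.coeff_deriv_c hx) n using 1
    rw [hs _ n (h.coeff_zero_c x), ← PowerSeries.coeff_C_mul (φ := g * a x), two_eq_C,
      ← PowerSeries.coeff_C_mul, ← PowerSeries.coeff_C_mul, ← map_add]
    congr 1
    ring
  · rw [PowerSeries.coeff_mul, Finset.Nat.antidiagonal_zero, Finset.sum_singleton, h.coeff_zero_b,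
      mul_zero]
  · rw [PowerSeries.coeff_mul, Finset.Nat.antidiagonal_zero, Finset.sum_singleton, h.coeff_zero_c,
      mul_zero]

/-- A solution of the Lax equation with leading coefficient `a₀ = -1` is determined by `a² + bc`:
the equation for `b`, `c` gives the next coefficient of these two, and then `a² + bc` gives that
of `a`. -/
theorem IsLaxSeries.eq {a₂ b₂ c₂ : ℝ → ℝ⟦X⟧} (h : IsLaxSeries q r I a b c)
    (h₂ : IsLaxSeries q r I a₂ b₂ c₂) (hI : IsOpen I)
    (ha : ∀ x ∈ I, coeff 0 (a x) = -1) (ha₂ : ∀ x ∈ I, coeff 0 (a₂ x) = -1)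
    (hdet : ∀ x ∈ I, a x * a x + b x * c x = a₂ x * a₂ x + b₂ x * c₂ x) {x : ℝ} (hx : x ∈ I) :
    a x = a₂ x ∧ b x = b₂ x ∧ c x = c₂ x := by
  have key : ∀ n, ∀ x ∈ I, ∀ m < n + 1, coeff m (a x) = coeff m (a₂ x) ∧
      coeff m (b x) = coeff m (b₂ x) ∧ coeff m (c x) = coeff m (c₂ x) := by
    intro n
    induction n with
    | zero =>
      intro x hx m hm
      obtain rfl : m = 0 := by omega
      rw [ha x hx, ha₂ x hx, h.coeff_zero_b, h.coeff_zero_c, h₂.coeff_zero_b, h₂.coeff_zero_c]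
      exact ⟨rfl, rfl, rfl⟩
    | succ n ih =>
      -- Comparing derivatives of the `n`-th coefficients gives the next coefficients of `b`, `c`.
      have hb : ∀ x ∈ I, coeff (n + 1) (b x) = coeff (n + 1) (b₂ x) := by
        intro x hx
        have e := (h.hasDerivAt_b x hx n).unique ((h₂.hasDerivAt_b x hx n).congr_of_eventuallyEq
          (Filter.eventually_of_mem (hI.mem_nhds hx) fun y hy => (ih y hy n (by omega)).2.1))
        rw [(ih x hx n (by omega)).1] at e
        linarith
      have hc : ∀ x ∈ I, coeff (n + 1) (c x) = coeff (n + 1) (c₂ x) := by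
        intro x hx
        have e := (h.hasDerivAt_c x hx n).unique ((h₂.hasDerivAt_c x hx n).congr_of_eventuallyEq
          (Filter.eventually_of_mem (hI.mem_nhds hx) fun y hy => (ih y hy n (by omega)).2.2))
        rw [(ih x hx n (by omega)).1] at e
        linarith
      intro x hx
      have db : PowerSeries.X ^ (n + 1 + 1) ∣ b x - b₂ x := by
        refine PowerSeries.X_pow_dvd_iff.mpr fun m hm => ?_
        rw [map_sub, sub_eq_zero]
        rcases Nat.lt_succ_iff_lt_or_eq.mp hm with h' | rfl
        exacts [(ih x hx m h').2.1, hb x hx]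
      have dc : PowerSeries.X ^ (n + 1 + 1) ∣ c x - c₂ x := by
        refine PowerSeries.X_pow_dvd_iff.mpr fun m hm => ?_
        rw [map_sub, sub_eq_zero]
        rcases Nat.lt_succ_iff_lt_or_eq.mp hm with h' | rfl
        exacts [(ih x hx m h').2.2, hc x hx]
      -- `a + a₂` has constant term `-2`, so it is a unit and can be cancelled.
      have hu : IsUnit (a x + a₂ x) := by
        rw [PowerSeries.isUnit_iff_constantCoeff, ← PowerSeries.coeff_zero_eq_constantCoeff_apply,
          map_add, ha x hx, ha₂ x hx]
        norm_num
      have da : PowerSeries.X ^ (n + 1 + 1) ∣ a x - a₂ x := by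
        rw [← hu.dvd_mul_right]
        have e : (a x - a₂ x) * (a x + a₂ x)
            = -((b x - b₂ x) * c x) - b₂ x * (c x - c₂ x) := by
          linear_combination hdet x hx
        rw [e]
        exact ((db.mul_right _).neg_right).sub (dc.mul_left _)
      intro m hm
      have za := PowerSeries.X_pow_dvd_iff.mp da m hm
      have zb := PowerSeries.X_pow_dvd_iff.mp db m hm
      have zc := PowerSeries.X_pow_dvd_iff.mp dc m hm
      rw [map_sub, sub_eq_zero] at za zb zc
      exact ⟨za, zb, zc⟩
  exact ⟨PowerSeries.ext fun n => (key n x hx n (by omega)).1,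
    PowerSeries.ext fun n => (key n x hx n (by omega)).2.1,
    PowerSeries.ext fun n => (key n x hx n (by omega)).2.2⟩

/-! ### The standard solution -/

theorem coeff_D_mul {f g f' g' : DiffPoly⟦X⟧} (hf : ∀ n, D (coeff n f) = coeff n f')
    (hg : ∀ n, D (coeff n g) = coeff n g') (n : ℕ) :
    D (coeff n (f * g)) = coeff n (f' * g + f * g') := by
  simp only [map_add, PowerSeries.coeff_mul, map_sum, ← Finset.sum_add_distrib, Derivation.leibniz,
    smul_eq_mul, hf, hg]
  exact Finset.sum_congr rfl fun p _ => by ring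

/-- The generating series `A = ∑ aᵢ tⁱ`, `B = ∑ bᵢ tⁱ`, `C = ∑ cᵢ tⁱ` satisfy `A² + BC = 1`:
the left side has zero total derivative, and its higher coefficients vanish at `q = r = 0`. -/
theorem standard_det : PowerSeries.mk ca * PowerSeries.mk ca
    + PowerSeries.mk cb * PowerSeries.mk cc = (1 : DiffPoly⟦X⟧) := by
  have hC : (2 : DiffPoly⟦X⟧) = PowerSeries.C 2 := (map_ofNat _ 2).symm
  have h2 : (MvPolynomial.C (2 : ℝ) : DiffPoly) = 2 := map_ofNat _ 2
  have ha : ∀ n, D (coeff n (PowerSeries.mk ca)) = coeff n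
      (PowerSeries.C dq * PowerSeries.mk cc - PowerSeries.C dr * PowerSeries.mk cb) := fun n => by
    rw [map_sub, PowerSeries.coeff_C_mul, PowerSeries.coeff_C_mul]
    simpa only [PowerSeries.coeff_mk] using (D_ca n).1
  have hb : ∀ n, D (coeff n (PowerSeries.mk cb)) = coeff n
      (-2 * (PowerSeries.mk fun n => coeff (n + 1) (PowerSeries.mk cb))
        - 2 * (PowerSeries.C dq * PowerSeries.mk ca)) := fun n => by
    rw [neg_mul, hC]
    simp only [map_sub, map_neg, PowerSeries.coeff_C_mul, PowerSeries.coeff_mk, D_cb,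
      MvPolynomial.smul_eq_C_mul, h2]
    ring
  have hc : ∀ n, D (coeff n (PowerSeries.mk cc)) = coeff n
      (2 * (PowerSeries.mk fun n => coeff (n + 1) (PowerSeries.mk cc))
        + 2 * (PowerSeries.C dr * PowerSeries.mk ca)) := fun n => by
    rw [hC]
    simp only [map_add, PowerSeries.coeff_C_mul, PowerSeries.coeff_mk, D_cc,
      MvPolynomial.smul_eq_C_mul, h2]
  have h0b : coeff 0 (PowerSeries.mk cb) = 0 := PowerSeries.coeff_mk _ _
  have h0c : coeff 0 (PowerSeries.mk cc) = 0 := PowerSeries.coeff_mk _ _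
  have hD : ∀ n, D (coeff n (PowerSeries.mk ca * PowerSeries.mk ca
      + PowerSeries.mk cb * PowerSeries.mk cc)) = 0 := fun n => by
    have e := lax_derivative_det (PowerSeries.C dq) (PowerSeries.C dr) (PowerSeries.mk ca)
      (PowerSeries.mk fun n => coeff (n + 1) (PowerSeries.mk cb))
      (PowerSeries.mk fun n => coeff (n + 1) (PowerSeries.mk cc)) PowerSeries.X
    rw [← eq_X_mul_shift h0b, ← eq_X_mul_shift h0c] at e
    rw [map_add, map_add, coeff_D_mul ha ha, coeff_D_mul hb hc, ← map_add, e, map_zero]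
  ext1 n
  rw [eq_C_of_D_eq_zero _ (hD n)]
  cases n with
  | zero => simp [ca, cb, cc, coeffs]
  | succ n =>
    rw [PowerSeries.coeff_one, if_neg n.succ_ne_zero, ← map_zero MvPolynomial.C]
    congr 1
    simp only [map_add, PowerSeries.coeff_mul, PowerSeries.coeff_mk, map_sum, map_mul,
      constantCoeff_cb, zero_mul, Finset.sum_const_zero, add_zero]
    refine Finset.sum_eq_zero fun p hp => ?_
    have hp' := Finset.HasAntidiagonal.mem_antidiagonal.mp hp
    rcases Nat.eq_zero_or_pos p.1 with h | h
    · rw [(D_ca p.2).2 (by omega), mul_zero]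
    · rw [(D_ca p.1).2 h, zero_mul]

/-- Evaluation at `x` along `q`, `r`, as a ring homomorphism. -/
def evalHom (q r : ℝ → ℝ) (x : ℝ) : DiffPoly →+* ℝ :=
  MvPolynomial.eval fun s => iteratedDeriv s.2 (![q, r] s.1) x

theorem evalHom_dq (q r : ℝ → ℝ) (x : ℝ) : evalHom q r x dq = q x := by
  simp [evalHom, dq]

theorem evalHom_dr (q r : ℝ → ℝ) (x : ℝ) : evalHom q r x dr = r x := by
  simp [evalHom, dr]

theorem evalHom_smul (q r : ℝ → ℝ) (x s : ℝ) (p : DiffPoly) :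
    evalHom q r x (s • p) = s * evalHom q r x p := by
  simp [evalHom, MvPolynomial.smul_eval]

theorem hasDerivAt_evalHom (hI : IsOpen I) (hq : ContDiffOn ℝ ∞ q I) (hr : ContDiffOn ℝ ∞ r I)
    {x : ℝ} (hx : x ∈ I) (p : DiffPoly) :
    HasDerivAt (fun y => evalHom q r y p) (evalHom q r x (D p)) x := by
  have hs : ∀ f : ℝ → ℝ, ContDiffOn ℝ ∞ f I → ∀ k,
      HasDerivAt (iteratedDeriv k f) (iteratedDeriv (k + 1) f x) x := by
    intro f hf k
    have hk : ContDiffOn ℝ ∞ (iteratedDeriv k f) I := by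
      induction k with
      | zero => rwa [iteratedDeriv_zero]
      | succ k ih =>
        rw [iteratedDeriv_succ]
        exact ((contDiffOn_infty_iff_deriv_of_isOpen hI).mp ih).2
    rw [iteratedDeriv_succ]
    exact (((contDiffOn_infty_iff_deriv_of_isOpen hI).mp hk).1.differentiableAt
      (hI.mem_nhds hx)).hasDerivAt
  induction p using MvPolynomial.induction_on with
  | C s => simpa [evalHom, D] using hasDerivAt_const x s
  | add p p' hp hp' => simpa only [map_add] using hp.fun_add hp'
  | mul_X p s hp =>
    have hX : HasDerivAt (fun y => evalHom q r y (MvPolynomial.X s))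
        (evalHom q r x (MvPolynomial.X (s.1, s.2 + 1))) x := by
      obtain ⟨i, k⟩ := s
      simp only [evalHom, MvPolynomial.eval_X]
      fin_cases i
      exacts [hs q hq k, hs r hr k]
    have := hp.fun_mul hX
    rw [Derivation.leibniz, D_X, map_add, smul_eq_mul, smul_eq_mul, map_mul, map_mul, add_comm,
      mul_comm (evalHom q r x (MvPolynomial.X s))]
    simpa only [map_mul] using this

theorem standard_isLaxSeries (hI : IsOpen I) (hq : ContDiffOn ℝ ∞ q I) (hr : ContDiffOn ℝ ∞ r I) :
    IsLaxSeries q r I (fun x => (PowerSeries.mk ca).map (evalHom q r x))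
      (fun x => (PowerSeries.mk cb).map (evalHom q r x))
      (fun x => (PowerSeries.mk cc).map (evalHom q r x)) := by
  refine ⟨fun x hx n => ?_, fun x hx n => ?_, fun x hx n => ?_, fun x => ?_, fun x => ?_⟩ <;>
    simp only [PowerSeries.coeff_map, PowerSeries.coeff_mk]
  · simpa only [(D_ca n).1, map_sub, map_mul, evalHom_dq, evalHom_dr]
      using hasDerivAt_evalHom hI hq hr hx (ca n)
  · simpa only [D_cb n, map_sub, map_mul, evalHom_dq, evalHom_smul]
      using hasDerivAt_evalHom hI hq hr hx (cb n)
  · simpa only [D_cc n, map_add, map_mul, evalHom_dr, evalHom_smul]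
      using hasDerivAt_evalHom hI hq hr hx (cc n)
  · exact map_zero _
  · exact map_zero _

/-! ### The Lax matrix of the constrained system -/

variable {N : ℕ} {lam mu : Fin N → ℝ} {z : ℝ → Phase N}

/-- The `a`-component of `4` times the orthogonal projection, for the trace form, of
`φ⁽ʲ⁾ ψ⁽ʲ⁾ᵀ` to the matrices `V(a, b, c)`. -/
def eigA (z : Phase N) (j : Fin N) : ℝ := z.1 0 j * z.2 0 j - z.1 2 j * z.2 2 j

/-- The `b`-component of `4` times the orthogonal projection of `φ⁽ʲ⁾ ψ⁽ʲ⁾ᵀ` to the matrices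
`V(a, b, c)`. -/
def eigB (z : Phase N) (j : Fin N) : ℝ := √2 * (z.1 0 j * z.2 1 j + z.1 1 j * z.2 2 j)

/-- The `c`-component of `4` times the orthogonal projection of `φ⁽ʲ⁾ ψ⁽ʲ⁾ᵀ` to the matrices
`V(a, b, c)`. -/
def eigC (z : Phase N) (j : Fin N) : ℝ := √2 * (z.1 1 j * z.2 0 j + z.1 2 j * z.2 1 j)

theorem potQ_eq (mu : Fin N → ℝ) (z : Phase N) : potQ mu z = ∑ j, mu j * eigB z j := by
  simp only [potQ, pairB, dotProduct, Matrix.mulVec_diagonal, eigB, ← Finset.sum_add_distrib,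
    Finset.mul_sum]
  exact Finset.sum_congr rfl fun j _ => by ring

theorem potR_eq (mu : Fin N → ℝ) (z : Phase N) : potR mu z = ∑ j, mu j * eigC z j := by
  simp only [potR, pairB, dotProduct, Matrix.mulVec_diagonal, eigC, ← Finset.sum_add_distrib,
    Finset.mul_sum]
  exact Finset.sum_congr rfl fun j _ => by ring

theorem IsSolution.hasDerivAt_eigA (hz : IsSolution lam mu I z) {x : ℝ} (hx : x ∈ I)
    (j : Fin N) : HasDerivAt (fun y => eigA (z y) j)
      (potQ mu (z x) * eigC (z x) j - potR mu (z x) * eigB (z x) j) x := by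
  have h0 := hz x hx j 0
  have h2 := hz x hx j 2
  simp only [Matrix.mulVec, dotProduct, Fin.sum_univ_three, U, Matrix.neg_apply,
    Matrix.transpose_apply, Matrix.of_apply, Matrix.cons_val] at h0 h2
  refine ((h0.1.fun_mul h0.2).fun_sub (h2.1.fun_mul h2.2)).congr_deriv ?_
  simp only [eigB, eigC]
  ring

theorem IsSolution.hasDerivAt_eigB (hz : IsSolution lam mu I z) {x : ℝ} (hx : x ∈ I)
    (j : Fin N) : HasDerivAt (fun y => eigB (z y) j)
      (-2 * (lam j * eigB (z x) j) - 2 * (potQ mu (z x) * eigA (z x) j)) x := by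
  have h0 := hz x hx j 0
  have h1 := hz x hx j 1
  have h2 := hz x hx j 2
  simp only [Matrix.mulVec, dotProduct, Fin.sum_univ_three, U, Matrix.neg_apply,
    Matrix.transpose_apply, Matrix.of_apply, Matrix.cons_val] at h0 h1 h2
  refine (((h0.1.fun_mul h1.2).fun_add (h1.1.fun_mul h2.2)).const_mul √2).congr_deriv ?_
  simp only [eigA, eigB]
  have h := Real.mul_self_sqrt (show (0 : ℝ) ≤ 2 by norm_num)
  linear_combination potQ mu (z x) * ((z x).1 2 j * (z x).2 2 j - (z x).1 0 j * (z x).2 0 j) * h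

theorem IsSolution.hasDerivAt_eigC (hz : IsSolution lam mu I z) {x : ℝ} (hx : x ∈ I)
    (j : Fin N) : HasDerivAt (fun y => eigC (z y) j)
      (2 * (lam j * eigC (z x) j) + 2 * (potR mu (z x) * eigA (z x) j)) x := by
  have h0 := hz x hx j 0
  have h1 := hz x hx j 1
  have h2 := hz x hx j 2
  simp only [Matrix.mulVec, dotProduct, Fin.sum_univ_three, U, Matrix.neg_apply,
    Matrix.transpose_apply, Matrix.of_apply, Matrix.cons_val] at h0 h1 h2
  refine (((h1.1.fun_mul h0.2).fun_add (h2.1.fun_mul h1.2)).const_mul √2).congr_deriv ?_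
  simp only [eigA, eigC]
  have h := Real.mul_self_sqrt (show (0 : ℝ) ≤ 2 by norm_num)
  linear_combination potR mu (z x) * ((z x).1 0 j * (z x).2 0 j - (z x).1 2 j * (z x).2 2 j) * h

/-- The expansion of `∑ⱼ μⱼ fⱼ / (l - λⱼ)` in powers of `t = l⁻¹`. -/
def momentSeries (lam mu f : Fin N → ℝ) : ℝ⟦X⟧ :=
  PowerSeries.X * PowerSeries.mk fun n => ∑ j, lam j ^ n * (mu j * f j)

theorem coeff_zero_momentSeries (lam mu f : Fin N → ℝ) : coeff 0 (momentSeries lam mu f) = 0 := by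
  rw [momentSeries, PowerSeries.coeff_zero_X_mul]

theorem coeff_succ_momentSeries (lam mu f : Fin N → ℝ) (n : ℕ) :
    coeff (n + 1) (momentSeries lam mu f) = ∑ j, lam j ^ n * (mu j * f j) := by
  rw [momentSeries, PowerSeries.coeff_succ_X_mul, PowerSeries.coeff_mk]

theorem coeff_neg_one_succ (n : ℕ) : coeff (n + 1) (-1 : ℝ⟦X⟧) = 0 := by
  rw [map_neg, PowerSeries.coeff_one, if_neg n.succ_ne_zero, neg_zero]

/-- The Bargmann constraint says that the first coefficients of `b`, `c` are `q`, `r`; this is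
what the Lax equation asks for at order `t⁰`. -/
theorem bargmann_isLaxSeries (hz : IsSolution lam mu I z) :
    IsLaxSeries (fun x => potQ mu (z x)) (fun x => potR mu (z x)) I
      (fun x => -1 + momentSeries lam mu (eigA (z x)))
      (fun x => momentSeries lam mu (eigB (z x)))
      (fun x => momentSeries lam mu (eigC (z x))) := by
  have h0 : coeff 0 (-1 : ℝ⟦X⟧) = -1 := by rw [map_neg, PowerSeries.coeff_zero_one]
  refine ⟨fun x hx n => ?_, fun x hx n => ?_, fun x hx n => ?_,
    fun _ => coeff_zero_momentSeries _ _ _, fun _ => coeff_zero_momentSeries _ _ _⟩ <;>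
    cases n <;>
    simp only [map_add, coeff_zero_momentSeries, coeff_succ_momentSeries, h0,
      coeff_neg_one_succ, zero_add]
  · exact (hasDerivAt_const x _).congr_deriv (by ring)
  · refine (HasDerivAt.fun_sum fun j _ => ((hz.hasDerivAt_eigA hx j).const_mul (mu j)).const_mul
      (lam j ^ _)).congr_deriv ?_
    simp only [Finset.mul_sum, ← Finset.sum_sub_distrib]
    exact Finset.sum_congr rfl fun j _ => by ring
  · refine (hasDerivAt_const x _).congr_deriv ?_
    simp only [pow_zero, one_mul, ← potQ_eq]
    ring
  · refine (HasDerivAt.fun_sum fun j _ => ((hz.hasDerivAt_eigB hx j).const_mul (mu j)).const_mul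
      (lam j ^ _)).congr_deriv ?_
    simp only [Finset.mul_sum, ← Finset.sum_sub_distrib]
    exact Finset.sum_congr rfl fun j _ => by ring
  · refine (hasDerivAt_const x _).congr_deriv ?_
    simp only [pow_zero, one_mul, ← potR_eq]
    ring
  · refine (HasDerivAt.fun_sum fun j _ => ((hz.hasDerivAt_eigC hx j).const_mul (mu j)).const_mul
      (lam j ^ _)).congr_deriv ?_
    simp only [Finset.mul_sum, ← Finset.sum_add_distrib]
    exact Finset.sum_congr rfl fun j _ => by ring

/-! ### Smoothness -/

theorem contDiff_potQ (mu : Fin N → ℝ) : ContDiff ℝ ∞ (potQ mu) := by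
  simp only [funext (potQ_eq mu), eigB]
  fun_prop

theorem contDiff_potR (mu : Fin N → ℝ) : ContDiff ℝ ∞ (potR mu) := by
  simp only [funext (potR_eq mu), eigC]
  fun_prop

/-- Solutions of the constrained system are smooth, since its right-hand side is. -/
theorem IsSolution.contDiffOn (hz : IsSolution lam mu I z) (hI : IsOpen I) :
    ContDiffOn ℝ ∞ z I := by
  have hU : ∀ (l : ℝ) (i k : Fin 3),
      ContDiff ℝ ∞ fun w : Phase N => U (potQ mu w) (potR mu w) l i k := by
    intro l i k
    have hq := contDiff_potQ mu
    have hr := contDiff_potR mu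
    fin_cases i <;> fin_cases k <;> simp only [U, Matrix.of_apply, Matrix.cons_val, Fin.zero_eta,
      Fin.mk_one, Fin.reduceFinMk] <;> fun_prop
  have h1 : ∀ (j : Fin N) (i : Fin 3), ContDiff ℝ ∞ fun w : Phase N =>
      (U (potQ mu w) (potR mu w) (lam j)).mulVec (fun k => w.1 k j) i := by
    intro j i
    simp only [Matrix.mulVec, dotProduct]
    exact ContDiff.sum fun k _ => (hU _ _ _).mul (by fun_prop)
  have h2 : ∀ (j : Fin N) (i : Fin 3), ContDiff ℝ ∞ fun w : Phase N =>
      (-(U (potQ mu w) (potR mu w) (lam j)).transpose).mulVec (fun k => w.2 k j) i := by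
    intro j i
    simp only [Matrix.mulVec, dotProduct, Matrix.neg_apply, Matrix.transpose_apply]
    exact ContDiff.sum fun k _ => (hU _ _ _).neg.mul (by fun_prop)
  refine contDiffOn_infty.mpr fun n => ?_
  induction n with
  | zero =>
    refine contDiffOn_zero.mpr fun x hx => ContinuousAt.continuousWithinAt ?_
    refine ContinuousAt.prodMk ?_ ?_ <;>
      refine continuousAt_pi.mpr fun i => continuousAt_pi.mpr fun j => ?_
    exacts [(hz x hx j i).1.continuousAt, (hz x hx j i).2.continuousAt]
  | succ n ih =>
    have hstep : ∀ (f : ℝ → ℝ) (F : Phase N → ℝ), ContDiff ℝ ∞ F →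
        (∀ x ∈ I, HasDerivAt f (F (z x)) x) → ContDiffOn ℝ (n + 1 : ℕ) f I := by
      intro f F hF hf
      rw [Nat.cast_succ, contDiffOn_succ_iff_deriv_of_isOpen hI]
      refine ⟨fun x hx => (hf x hx).differentiableAt.differentiableWithinAt, fun h => ?_, ?_⟩
      · exact absurd h (by simp)
      · exact ((hF.of_le (by exact_mod_cast le_top)).comp_contDiffOn ih).congr
          fun x hx => (hf x hx).deriv
    refine ContDiffOn.prodMk ?_ ?_ <;>
      refine contDiffOn_pi.mpr fun i => contDiffOn_pi.mpr fun j => ?_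
    exacts [hstep _ _ (h1 j i) fun x hx => (hz x hx j i).1,
      hstep _ _ (h2 j i) fun x hx => (hz x hx j i).2]

theorem contDiff_coeff_momentSeries (lam mu : Fin N → ℝ) {f : Phase N → Fin N → ℝ}
    (hf : ∀ j, ContDiff ℝ ∞ fun z => f z j) (n : ℕ) :
    ContDiff ℝ ∞ fun z => coeff n (momentSeries lam mu (f z)) := by
  cases n with
  | zero => simpa only [coeff_zero_momentSeries] using contDiff_const
  | succ n =>
    simp only [coeff_succ_momentSeries]
    exact ContDiff.sum fun j _ => contDiff_const.mul (contDiff_const.mul (hf j))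

/-! ### The integrals of motion -/

/-- The generating function `a² + bc` of the invariants of the Lax matrix of the constrained
system. -/
def detSeries (lam mu : Fin N → ℝ) (z : Phase N) : ℝ⟦X⟧ :=
  (-1 + momentSeries lam mu (eigA z)) * (-1 + momentSeries lam mu (eigA z))
    + momentSeries lam mu (eigB z) * momentSeries lam mu (eigC z)

theorem coeff_zero_detSeries (lam mu : Fin N → ℝ) (z : Phase N) :
    coeff 0 (detSeries lam mu z) = 1 := by
  simp [detSeries, momentSeries]

theorem contDiff_coeff_detSeries (lam mu : Fin N → ℝ) (n : ℕ) :
    ContDiff ℝ ∞ fun z => coeff n (detSeries lam mu z) := by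
  have hA : ∀ n, ContDiff ℝ ∞ fun z : Phase N => coeff n (-1 + momentSeries lam mu (eigA z)) := by
    intro n
    simp only [map_add]
    exact contDiff_const.add (contDiff_coeff_momentSeries lam mu
      (fun j => by simp only [eigA]; fun_prop) n)
  have hB := contDiff_coeff_momentSeries lam mu (f := eigB)
    (fun j => by simp only [eigB]; fun_prop)
  have hC := contDiff_coeff_momentSeries lam mu (f := eigC)
    (fun j => by simp only [eigC]; fun_prop)
  simp only [detSeries, map_add]
  exact (contDiff_coeff_mul hA hA n).add (contDiff_coeff_mul hB hC n)

/-- The coefficient of `Kᵢ` in the stationary equation: the coefficient of `lⁱ` in the product of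
`∏ⱼ (l - λⱼ)` and the series `√(a² + bc)` in `l⁻¹`. -/
def motionIntegral (lam mu : Fin N → ℝ) (i : ℕ) (z : Phase N) : ℝ :=
  ∑ m ∈ Finset.Ico i (N + 1), (Lagrange.nodal Finset.univ lam).coeff m
    * coeff (m - i) (sqrtSeries (detSeries lam mu z))

theorem coeff_nodal (lam : Fin N → ℝ) : (Lagrange.nodal Finset.univ lam).coeff N = 1 := by
  have h := (Lagrange.nodal_monic (s := Finset.univ) (v := lam)).coeff_natDegree
  rwa [Lagrange.natDegree_nodal, Finset.card_univ, Fintype.card_fin] at h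

theorem motionIntegral_top (lam mu : Fin N → ℝ) (z : Phase N) : motionIntegral lam mu N z = 1 := by
  rw [motionIntegral, Nat.Ico_succ_singleton, Finset.sum_singleton, Nat.sub_self,
    coeff_zero_sqrtSeries, coeff_nodal, one_mul]

theorem isIntegralOfMotion_motionIntegral (lam mu : Fin N → ℝ) (i : ℕ) :
    IsIntegralOfMotion lam mu (motionIntegral lam mu i) := by
  refine ⟨?_, fun I hI hc z hz x hx y hy => ?_⟩
  · exact ContDiff.sum fun m _ => contDiff_const.mul
      (contDiff_coeff_sqrtSeries (contDiff_coeff_detSeries lam mu) _)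
  · have h : detSeries lam mu (z x) = detSeries lam mu (z y) :=
      (bargmann_isLaxSeries hz).det_eq hI hc hx hy
    rw [motionIntegral, motionIntegral, h]

/-! ### The stationary equation -/

/-- Along a solution the expansion of the Lax matrix is the standard solution of the Lax equation
multiplied by the constant series `√(a² + bc)`. -/
theorem momentSeries_eq (hz : IsSolution lam mu I z) (hI : IsOpen I) (hc : I.OrdConnected)
    (hq : ContDiffOn ℝ ∞ (fun x => potQ mu (z x)) I)
    (hr : ContDiffOn ℝ ∞ (fun x => potR mu (z x)) I) {x : ℝ} (hx : x ∈ I) :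
    momentSeries lam mu (eigB (z x)) = sqrtSeries (detSeries lam mu (z x)) *
        (PowerSeries.mk cb).map (evalHom (fun x => potQ mu (z x)) (fun x => potR mu (z x)) x) ∧
      momentSeries lam mu (eigC (z x)) = sqrtSeries (detSeries lam mu (z x)) *
        (PowerSeries.mk cc).map (evalHom (fun x => potQ mu (z x)) (fun x => potR mu (z x)) x) := by
  have hL := bargmann_isLaxSeries hz
  have hS := (standard_isLaxSeries hI hq hr).const_mul (sqrtSeries (detSeries lam mu (z x)))
  refine (hL.eq hS hI (fun y _ => ?_) (fun y _ => ?_) (fun y hy => ?_) hx).2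
  · simp [momentSeries]
  · rw [PowerSeries.coeff_mul, Finset.Nat.antidiagonal_zero, Finset.sum_singleton,
      coeff_zero_sqrtSeries]
    simp [ca, coeffs]
  · have h1 := congrArg (PowerSeries.map (evalHom (fun x => potQ mu (z x))
      (fun x => potR mu (z x)) y)) standard_det
    rw [map_add, map_mul, map_mul, map_one] at h1
    have h2 := sqrtSeries_mul_self (coeff_zero_detSeries lam mu (z x))
    have h3 := hL.det_eq hI hc hy hx
    rw [h3, ← detSeries]
    linear_combination (-1 : ℝ⟦X⟧) * h2 - sqrtSeries (detSeries lam mu (z x))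
      * sqrtSeries (detSeries lam mu (z x)) * h1

/-- The moments of `f` satisfy the linear recurrence with characteristic polynomial
`∏ⱼ (l - λⱼ)`; hence so do, in the given combination, the coefficients of a quotient `E`
of the moment series by a power series. -/
theorem sum_motionIntegral_mul_coeff (lam mu f : Fin N → ℝ) (w : Phase N) {E : ℝ⟦X⟧}
    (hE : coeff 0 E = 0)
    (h : momentSeries lam mu f = sqrtSeries (detSeries lam mu w) * E) :
    ∑ i ∈ Finset.range (N + 1), motionIntegral lam mu i w * coeff (i + 1) E = 0 := by
  set g := sqrtSeries (detSeries lam mu w) with hg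
  set P := Lagrange.nodal Finset.univ lam with hP
  have hm : ∀ m, ∑ j, lam j ^ m * (mu j * f j)
      = ∑ i ∈ Finset.Ico 0 (m + 1), coeff (i + 1) E * coeff (m - i) g := by
    intro m
    rw [← coeff_succ_momentSeries, h, mul_comm]
    conv_lhs => rw [eq_X_mul_shift hE]
    rw [mul_assoc, PowerSeries.coeff_succ_X_mul, PowerSeries.coeff_mul,
      Finset.Nat.sum_antidiagonal_eq_sum_range_succ_mk, Finset.range_eq_Ico]
    simp only [PowerSeries.coeff_mk, Nat.succ_eq_add_one]
  have hdeg : P.natDegree < N + 1 := by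
    rw [hP, Lagrange.natDegree_nodal, Finset.card_univ, Fintype.card_fin]
    exact N.lt_succ_self
  have hzero : ∑ m ∈ Finset.Ico 0 (N + 1), P.coeff m * ∑ j, lam j ^ m * (mu j * f j) = 0 := by
    simp only [Finset.mul_sum]
    rw [Finset.sum_comm, ← Finset.range_eq_Ico]
    refine Finset.sum_eq_zero fun j _ => ?_
    have hj : P.eval (lam j) = 0 := Lagrange.eval_nodal_at_node (Finset.mem_univ j)
    rw [Polynomial.eval_eq_sum_range' hdeg] at hj
    simp only [← mul_assoc]
    rw [← Finset.sum_mul, ← Finset.sum_mul, hj, zero_mul, zero_mul]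
  simp only [hm, Finset.mul_sum] at hzero
  rw [← Finset.sum_Ico_Ico_comm] at hzero
  rw [Finset.range_eq_Ico, ← hzero]
  refine Finset.sum_congr rfl fun i _ => ?_
  rw [motionIntegral, Finset.sum_mul]
  exact Finset.sum_congr rfl fun m _ => by ring

/-! ### The polynomial Lax matrix -/

/-- The polynomial `∏ⱼ (l - λⱼ) (s + ∑ⱼ μⱼ fⱼ / (l - λⱼ))`. -/
def clearedPoly (lam mu : Fin N → ℝ) (s : ℝ) (f : Fin N → ℝ) : Polynomial ℝ :=
  Polynomial.C s * Lagrange.nodal Finset.univ lam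
    + ∑ j, Polynomial.C (mu j * f j) * Lagrange.nodal (Finset.univ.erase j) lam

theorem natDegree_nodal_erase_lt (lam : Fin N → ℝ) (j : Fin N) :
    (Lagrange.nodal (Finset.univ.erase j) lam).natDegree < N := by
  rw [Lagrange.natDegree_nodal, Finset.card_erase_of_mem (Finset.mem_univ j), Finset.card_univ,
    Fintype.card_fin]
  have := j.pos
  omega

theorem natDegree_clearedPoly_lt (lam mu : Fin N → ℝ) (s : ℝ) (f : Fin N → ℝ) :
    (clearedPoly lam mu s f).natDegree < N + 1 := by
  refine Nat.lt_succ_of_le (Polynomial.natDegree_add_le_of_degree_le ?_ ?_)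
  · refine (Polynomial.natDegree_C_mul_le _ _).trans ?_
    rw [Lagrange.natDegree_nodal, Finset.card_univ, Fintype.card_fin]
  · exact Polynomial.natDegree_sum_le_of_forall_le _ _ fun j _ =>
      (Polynomial.natDegree_C_mul_le _ _).trans (natDegree_nodal_erase_lt lam j).le

theorem coeff_clearedPoly (lam mu : Fin N → ℝ) (s : ℝ) (f : Fin N → ℝ) :
    (clearedPoly lam mu s f).coeff N = s := by
  rw [clearedPoly, Polynomial.coeff_add, Polynomial.finsetSum_coeff, Polynomial.coeff_C_mul,
    coeff_nodal, mul_one, Finset.sum_eq_zero, add_zero]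
  intro j _
  rw [Polynomial.coeff_C_mul,
    Polynomial.coeff_eq_zero_of_natDegree_lt (natDegree_nodal_erase_lt lam j), mul_zero]

theorem eval_clearedPoly (lam mu : Fin N → ℝ) (s : ℝ) (f : Fin N → ℝ) (l : ℝ) :
    (clearedPoly lam mu s f).eval l = s * (Lagrange.nodal Finset.univ lam).eval l
      + ∑ j, mu j * f j * (Lagrange.nodal (Finset.univ.erase j) lam).eval l := by
  simp only [clearedPoly, Polynomial.eval_add, Polynomial.eval_mul, Polynomial.eval_C,
    Polynomial.eval_finsetSum]

theorem hasDerivAt_eval_clearedPoly (lam mu : Fin N → ℝ) (s l : ℝ) {f : ℝ → Fin N → ℝ}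
    {f' : Fin N → ℝ} {x : ℝ} (hf : ∀ j, HasDerivAt (fun y => f y j) (f' j) x) :
    HasDerivAt (fun y => (clearedPoly lam mu s (f y)).eval l)
      (∑ j, mu j * f' j * (Lagrange.nodal (Finset.univ.erase j) lam).eval l) x := by
  simp only [eval_clearedPoly]
  exact (HasDerivAt.fun_sum fun j _ => ((hf j).const_mul (mu j)).mul_const _).const_add _

/-- Multiplying the `j`-th pole part by `λⱼ` instead of `l` costs a multiple of
`∏ⱼ (l - λⱼ)`. -/
theorem sum_lam_mul_nodal (lam mu f : Fin N → ℝ) (l : ℝ) :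
    ∑ j, mu j * (lam j * f j) * (Lagrange.nodal (Finset.univ.erase j) lam).eval l
      = l * (clearedPoly lam mu 0 f).eval l
        - (∑ j, mu j * f j) * (Lagrange.nodal Finset.univ lam).eval l := by
  rw [eval_clearedPoly, zero_mul, zero_add, Finset.mul_sum, Finset.sum_mul,
    ← Finset.sum_sub_distrib]
  refine Finset.sum_congr rfl fun j _ => ?_
  rw [Lagrange.nodal_eq_mul_nodal_erase (Finset.mem_univ j), Polynomial.eval_mul,
    Polynomial.eval_sub, Polynomial.eval_X, Polynomial.eval_C]
  ring

theorem hasDerivAt_V {A B C : ℝ → ℝ} {x u v l : ℝ}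
    (hA : HasDerivAt A (u * C x - v * B x) x)
    (hB : HasDerivAt B (-2 * (l * B x) - 2 * (u * A x)) x)
    (hC : HasDerivAt C (2 * (l * C x) + 2 * (v * A x)) x) (i j : Fin 3) :
    HasDerivAt (fun y => V (A y) (B y) (C y) i j)
      ((U u v l * V (A x) (B x) (C x) - V (A x) (B x) (C x) * U u v l) i j) x := by
  have h := Real.mul_self_sqrt (show (0 : ℝ) ≤ 2 by norm_num)
  fin_cases i <;> fin_cases j <;>
    simp only [U, V, Matrix.sub_apply, Matrix.mul_apply, Fin.sum_univ_three, Matrix.of_apply,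
      Matrix.cons_val, Fin.zero_eta, Fin.mk_one, Fin.reduceFinMk]
  · exact (hA.const_mul 2).congr_deriv (by linear_combination (v * B x - u * C x) * h)
  · exact (hB.const_mul √2).congr_deriv (by ring)
  · exact (hasDerivAt_const x _).congr_deriv (by ring)
  · exact (hC.const_mul √2).congr_deriv (by ring)
  · exact (hasDerivAt_const x _).congr_deriv (by ring)
  · exact (hB.const_mul √2).congr_deriv (by ring)
  · exact (hasDerivAt_const x _).congr_deriv (by ring)
  · exact (hC.const_mul √2).congr_deriv (by ring)
  · exact (hA.const_mul (-2)).congr_deriv (by linear_combination (u * C x - v * B x) * h)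

theorem IsSolution.isFiniteGap (hz : IsSolution lam mu I z) :
    IsFiniteGap I (fun x => potQ mu (z x)) (fun x => potR mu (z x)) := by
  refine ⟨N, fun k x => (clearedPoly lam mu (-1) (eigA (z x))).coeff k,
    fun k x => (clearedPoly lam mu 0 (eigB (z x))).coeff k,
    fun k x => (clearedPoly lam mu 0 (eigC (z x))).coeff k,
    fun x _ => coeff_clearedPoly _ _ _ _, fun x hx l i j => ?_⟩
  simp only [polyV, ← Polynomial.eval_eq_sum_range' (natDegree_clearedPoly_lt _ _ _ _)]
  refine hasDerivAt_V ?_ ?_ ?_ i j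
  · refine (hasDerivAt_eval_clearedPoly lam mu (-1) l fun j =>
      hz.hasDerivAt_eigA hx j).congr_deriv ?_
    simp only [eval_clearedPoly, zero_mul, zero_add, Finset.mul_sum, ← Finset.sum_sub_distrib]
    exact Finset.sum_congr rfl fun j _ => by ring
  · refine (hasDerivAt_eval_clearedPoly lam mu 0 l fun j =>
      hz.hasDerivAt_eigB hx j).congr_deriv ?_
    have e := sum_lam_mul_nodal lam mu (eigB (z x)) l
    rw [← potQ_eq] at e
    have e2 : ∑ j, mu j * (-2 * (lam j * eigB (z x) j) - 2 * (potQ mu (z x) * eigA (z x) j))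
          * (Lagrange.nodal (Finset.univ.erase j) lam).eval l
        = -2 * ∑ j, mu j * (lam j * eigB (z x) j)
            * (Lagrange.nodal (Finset.univ.erase j) lam).eval l
          - 2 * potQ mu (z x) * ∑ j, mu j * eigA (z x) j
            * (Lagrange.nodal (Finset.univ.erase j) lam).eval l := by
      simp only [Finset.mul_sum, ← Finset.sum_sub_distrib]
      exact Finset.sum_congr rfl fun j _ => by ring
    rw [e2, e, eval_clearedPoly lam mu (-1)]
    ring
  · refine (hasDerivAt_eval_clearedPoly lam mu 0 l fun j =>
      hz.hasDerivAt_eigC hx j).congr_deriv ?_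
    have e := sum_lam_mul_nodal lam mu (eigC (z x)) l
    rw [← potR_eq] at e
    have e2 : ∑ j, mu j * (2 * (lam j * eigC (z x) j) + 2 * (potR mu (z x) * eigA (z x) j))
          * (Lagrange.nodal (Finset.univ.erase j) lam).eval l
        = 2 * ∑ j, mu j * (lam j * eigC (z x) j)
            * (Lagrange.nodal (Finset.univ.erase j) lam).eval l
          + 2 * potR mu (z x) * ∑ j, mu j * eigA (z x) j
            * (Lagrange.nodal (Finset.univ.erase j) lam).eval l := by
      simp only [Finset.mul_sum, ← Finset.sum_add_distrib]
      exact Finset.sum_congr rfl fun j _ => by ring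
    rw [e2, e, eval_clearedPoly lam mu (-1)]
    ring

end AKNS

end

theorem theorem4p2 (N : ℕ) (hN : 1 ≤ N) (lam mu : Fin N → ℝ)
    (hlam : Function.Injective lam) (hmu : ∀ j, mu j ≠ 0) :
    ∃ α : Fin N → AKNS.Phase N → ℝ,
      (∀ i, AKNS.IsIntegralOfMotion lam mu (α i)) ∧
      ∀ (I : Set ℝ) (_ : IsOpen I) (_ : I.OrdConnected) (z : ℝ → AKNS.Phase N)
        (_ : AKNS.IsSolution lam mu I z) (q r : ℝ → ℝ)
        (_ : q = fun x => AKNS.potQ mu (z x)) (_ : r = fun x => AKNS.potR mu (z x)),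
        (ContDiffOn ℝ ∞ q I ∧ ContDiffOn ℝ ∞ r I ∧
          ∀ x ∈ I, ∀ s : Fin 2,
            AKNS.evalAt q r x (AKNS.K N s)
              + ∑ i : Fin N, α i (z x) * AKNS.evalAt q r x (AKNS.K i s) = 0) ∧
        AKNS.IsFiniteGap I q r := by
  refine ⟨fun i => AKNS.motionIntegral lam mu i,
    fun i => AKNS.isIntegralOfMotion_motionIntegral lam mu i, ?_⟩
  rintro I hI hc z hz q r rfl rfl
  have hq : ContDiffOn ℝ ∞ (fun x => AKNS.potQ mu (z x)) I :=
    (AKNS.contDiff_potQ mu).comp_contDiffOn (hz.contDiffOn hI)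
  have hr : ContDiffOn ℝ ∞ (fun x => AKNS.potR mu (z x)) I :=
    (AKNS.contDiff_potR mu).comp_contDiffOn (hz.contDiffOn hI)
  refine ⟨⟨hq, hr, fun x hx s => ?_⟩, hz.isFiniteGap⟩
  obtain ⟨hb, hc'⟩ := AKNS.momentSeries_eq hz hI hc hq hr hx
  have eb := AKNS.sum_motionIntegral_mul_coeff lam mu _ (z x)
    ((AKNS.standard_isLaxSeries hI hq hr).coeff_zero_b x) hb
  have ec := AKNS.sum_motionIntegral_mul_coeff lam mu _ (z x)
    ((AKNS.standard_isLaxSeries hI hq hr).coeff_zero_c x) hc'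
  rw [Finset.sum_range_succ, AKNS.motionIntegral_top, one_mul, Finset.sum_range] at eb ec
  simp only [PowerSeries.coeff_map, PowerSeries.coeff_mk] at eb ec
  -- `evalAt` and `evalHom` are the same evaluation.
  change AKNS.evalHom _ _ x (AKNS.K N s)
    + ∑ i : Fin N, AKNS.motionIntegral lam mu i (z x) * AKNS.evalHom _ _ x (AKNS.K i s) = 0
  fin_cases s
  · simp only [AKNS.K, Fin.zero_eta, Matrix.cons_val, AKNS.evalHom_smul,
      mul_left_comm _ (-2 : ℝ), ← Finset.mul_sum]
    linear_combination (-2 : ℝ) * eb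
  · simp only [AKNS.K, Fin.mk_one, Matrix.cons_val, AKNS.evalHom_smul,
      mul_left_comm _ (2 : ℝ), ← Finset.mul_sum]
    linear_combination (2 : ℝ) * ec
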